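/- Let $k$ be a field and let $A$, $B$ be commutative Noetherian $k$-algebras such that $R := A\otimes_k B$ is Noetherian. Let $I\subseteq A$ and $J\subseteq B$ be nonzero proper ideals, and denote their extensions to $R$ again by $I$ and $J$. For an ideal $Q$ of a commutative Noetherian ring $S$ and an integer $m\ge 0$, let $$Q^{(m)} := S\cap\bigcap_{P\in \mathrm{Min}(Q)} Q^m S_P$$ be the $m$-th symbolic power, where $\mathrm{Min}(Q)$ is the set of minimal primes over $Q$ and $S\cap\,\cdot$ means preimage in $S$ (so $Q^{(0)}=Q^0=S$). Let $n\ge 1$ be an integer and assume that $I^t\ne I^{t+1}$ (in $A$) and $J^t\ne J^{t+1}$ (in $B$) for all integers $0\le t\le n-1$. Then $(I+J)^{(n)}=(I+J)^n$ in $R$ if and only if $I^{(t)}=I^t$ in $A$ and $J^{(t)}=J^t$ in $B$ for all integers $0\le t\le n$. -/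

import Mathlib

open scoped TensorProduct

/-- The symbolic power `Q⁽ⁿ⁾ = R ∩ ⋂_{P ∈ Min(Q)} Qⁿ R_P` of an ideal `Q` of a commutative ring `R`,
where `Min(Q)` is the set of minimal primes over `Q` and "`R ∩`" is contraction along `R → R_P`.
In particular `Q⁽⁰⁾ = R`. -/
noncomputable def symbolicPower {R : Type*} [CommRing R] (Q : Ideal R) (n : ℕ) : Ideal R :=
  ⨅ (P : Ideal R) (hP : P ∈ Q.minimalPrimes),
    haveI : P.IsPrime := Ideal.IsMinimalPrime.isPrime hP
    ((Q ^ n).map (algebraMap R (Localization.AtPrime P))).comap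
      (algebraMap R (Localization.AtPrime P))

/-- The extension to `A ⊗ B` of an ideal of the left factor `A`. -/
noncomputable def extLeft (k : Type*) {A : Type*} (B : Type*) [Field k] [CommRing A] [CommRing B]
    [Algebra k A] [Algebra k B] (I : Ideal A) : Ideal (A ⊗[k] B) :=
  I.map (Algebra.TensorProduct.includeLeft : A →ₐ[k] A ⊗[k] B)

/-- The extension to `A ⊗ B` of an ideal of the right factor `B`. -/
noncomputable def extRight (k : Type*) (A : Type*) {B : Type*} [Field k] [CommRing A] [CommRing B]
    [Algebra k A] [Algebra k B] (J : Ideal B) : Ideal (A ⊗[k] B) :=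
  J.map (Algebra.TensorProduct.includeRight : B →ₐ[k] A ⊗[k] B)

/-! Write Q = I + J in R = A ⊗ B. Tensoring over a field is exact, so the extended ideals satisfy
I^a ∩ J^b = I^a J^b, and Q^n is the intersection of the ideals I^i + J^j with i + j = n + 1 and 1 ≤
i, j ≤ n (`exists_notMem_sup_of_notMem_pow`). If symbolic and ordinary powers agree up to n, the
associated primes of A/I^i and B/J^j are minimal over I and J. The crux is that those of R/(I^i +
J^j) = A/I^i ⊗ B/J^j are then minimal over Q (`associatedPrime_mem_minimalPrimes`). This reduces to
K ⊗ L for fields K and L. That ring need not be a domain, but it is torsion-free over k[x] ⊗ L for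
algebraically independent x in K, and algebraicity over a transcendence basis does the rest.
Conversely, let x lie in the t-th symbolic power of I and y in J^(n-t) but not in J^(n-t+1). Then x
⊗ y lies in the n-th symbolic power of Q, which is Q^n ⊆ I^t + J^(n-t+1). A tensor of two nonzero
vectors is nonzero, so x ∈ I^t. -/

theorem mem_symbolicPower_iff {R : Type*} [CommRing R] {Q : Ideal R} {n : ℕ} {x : R} :
    x ∈ symbolicPower Q n ↔ ∀ P ∈ Q.minimalPrimes, ∃ s ∉ P, s * x ∈ Q ^ n := by
  simp only [symbolicPower, Submodule.mem_iInf]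
  refine forall₂_congr fun P hP ↦ ?_
  have : P.IsPrime := Ideal.IsMinimalPrime.isPrime hP
  rw [Ideal.mem_comap, IsLocalization.algebraMap_mem_map_algebraMap_iff P.primeCompl]
  rfl

theorem pow_le_symbolicPower {R : Type*} [CommRing R] (Q : Ideal R) (n : ℕ) :
    Q ^ n ≤ symbolicPower Q n := fun _ hx ↦ mem_symbolicPower_iff.2 fun P hP ↦
  ⟨1, (Ideal.ne_top_iff_one P).1 (Ideal.IsMinimalPrime.isPrime hP).ne_top, by simpa using hx⟩

/-! ### Extended ideals and powers of their sum -/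

section Ext

variable {k A B : Type*} [Field k] [CommRing A] [CommRing B] [Algebra k A] [Algebra k B]

theorem extLeft_pow (I : Ideal A) (n : ℕ) : extLeft k B (I ^ n) = extLeft k B I ^ n :=
  Ideal.map_pow _ _ _

theorem extRight_pow (J : Ideal B) (n : ℕ) : extRight k A (J ^ n) = extRight k A J ^ n :=
  Ideal.map_pow _ _ _

theorem tmul_mem_extLeft {I : Ideal A} {x : A} (hx : x ∈ I) (y : B) :
    x ⊗ₜ[k] y ∈ extLeft k B I := by
  have := Ideal.mul_mem_right ((1 : A) ⊗ₜ[k] y) _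
    (Ideal.mem_map_of_mem (Algebra.TensorProduct.includeLeft : A →ₐ[k] A ⊗[k] B) hx)
  simpa [extLeft] using this

theorem tmul_mem_extRight {J : Ideal B} (x : A) {y : B} (hy : y ∈ J) :
    x ⊗ₜ[k] y ∈ extRight k A J := by
  have := Ideal.mul_mem_left _ (x ⊗ₜ[k] (1 : B))
    (Ideal.mem_map_of_mem (Algebra.TensorProduct.includeRight : B →ₐ[k] A ⊗[k] B) hy)
  simpa [extRight] using this

theorem ker_map_mk (I : Ideal A) (J : Ideal B) :
    RingHom.ker (Algebra.TensorProduct.map (Ideal.Quotient.mkₐ k I) (Ideal.Quotient.mkₐ k J)) =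
      extLeft k B I ⊔ extRight k A J := by
  rw [Algebra.TensorProduct.map_ker _ _ (Ideal.Quotient.mkₐ_surjective k I)
    (Ideal.Quotient.mkₐ_surjective k J)]
  congr 2
  · exact Ideal.mk_ker
  · exact Ideal.mk_ker

/-- Lift x to I ⊗ B. Since I ⊗ B/J embeds in A ⊗ B/J, the lift dies in I ⊗ B/J, so it comes from I ⊗
J. -/
theorem extLeft_inf_extRight_le_mul (I : Ideal A) (J : Ideal B) :
    extLeft k B I ⊓ extRight k A J ≤ extLeft k B I * extRight k A J := by
  rintro x ⟨hx, hx'⟩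
  let U := I.restrictScalars k
  let W := J.restrictScalars k
  obtain ⟨y, rfl⟩ : ∃ y : U ⊗[k] B, U.subtype.rTensor B y = x := by
    refine Submodule.span_induction (p := fun x _ ↦ ∃ y : U ⊗[k] B, U.subtype.rTensor B y = x)
      ?_ ⟨0, map_zero _⟩ ?_ ?_ hx
    · rintro _ ⟨a, ha, rfl⟩
      exact ⟨(⟨a, ha⟩ : U) ⊗ₜ 1, by simp⟩
    · rintro _ _ - - ⟨y, rfl⟩ ⟨z, rfl⟩
      exact ⟨y + z, map_add _ _ _⟩
    · rintro r _ - ⟨y, rfl⟩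
      induction r with
      | zero => exact ⟨0, by simp⟩
      | add r s hr hs =>
        obtain ⟨u, hu⟩ := hr
        obtain ⟨v, hv⟩ := hs
        exact ⟨u + v, by rw [map_add, hu, hv, add_smul]⟩
      | tmul a b =>
        induction y with
        | zero => exact ⟨0, by simp⟩
        | add r s hr hs =>
          obtain ⟨u, hu⟩ := hr
          obtain ⟨v, hv⟩ := hs
          exact ⟨u + v, by rw [map_add, hu, hv, map_add, smul_add]⟩
        | tmul u c =>
          exact ⟨(⟨a * u, I.mul_mem_left a u.2⟩ : U) ⊗ₜ (b * c), by simp⟩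
  have hmk : ∀ x ∈ extRight k A J, W.mkQ.lTensor A x = 0 := by
    intro x hx
    -- The map is only `k`-linear, so the induction runs over all multiples of `x`.
    refine Submodule.span_induction (p := fun x _ ↦ ∀ r, W.mkQ.lTensor A (r * x) = 0)
      ?_ (by simp) ?_ ?_ hx 1 |> (by simpa using ·)
    · rintro _ ⟨b, hb, rfl⟩ r
      induction r with
      | zero => simp
      | add r s hr hs => rw [add_mul, map_add, hr, hs, add_zero]
      | tmul a c =>
        have : W.mkQ (c * b) = 0 :=
          (Submodule.Quotient.mk_eq_zero W).2 (J.mul_mem_left c hb)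
        simp only [Algebra.TensorProduct.includeRight_apply,
          Algebra.TensorProduct.tmul_mul_tmul, LinearMap.lTensor_tmul, this, TensorProduct.tmul_zero]
    · intro x y _ _ hx hy r
      rw [mul_add, map_add, hx, hy, add_zero]
    · intro a x _ hx r
      rw [smul_eq_mul, ← mul_assoc, hx]
  have h0 : W.mkQ.lTensor U y = 0 := by
    have hinj : Function.Injective (U.subtype.rTensor (B ⧸ W)) :=
      Module.Flat.rTensor_preserves_injective_linearMap _ U.injective_subtype
    apply hinj
    rw [map_zero, ← LinearMap.comp_apply, LinearMap.rTensor_comp_lTensor,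
      ← LinearMap.lTensor_comp_rTensor, LinearMap.comp_apply]
    exact hmk _ hx'
  have hex := lTensor_exact U (LinearMap.exact_subtype_mkQ W) W.mkQ_surjective
  obtain ⟨w, rfl⟩ := (hex y).1 h0
  have hmul : ∀ w : U ⊗[k] W, U.subtype.rTensor B (W.subtype.lTensor U w) ∈
      extLeft k B I * extRight k A J := by
    intro w
    induction w with
    | zero => simp
    | add r s hr hs =>
      rw [map_add, map_add]
      exact add_mem hr hs
    | tmul u v =>
      have := Ideal.mul_mem_mul (tmul_mem_extLeft (k := k) u.2 (1 : B))
        (tmul_mem_extRight (k := k) (1 : A) v.2)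
      simpa using this
  exact hmul w

/-- The bounds `i, j ≤ n` matter: equality of symbolic and ordinary powers is only available up to
`n`. -/
theorem exists_notMem_sup_of_notMem_pow {I : Ideal A} {J : Ideal B} {n : ℕ} {f : A ⊗[k] B}
    (hf : f ∉ (extLeft k B I + extRight k A J) ^ n) :
    ∃ i j, i ≤ n ∧ j ≤ n ∧ i + j ≤ n + 1 ∧ f ∉ extLeft k B (I ^ i) ⊔ extRight k A (J ^ j) := by
  by_contra! H
  apply hf
  set Q := extLeft k B I + extRight k A J
  have hQ : ∀ m ≤ n, extLeft k B (I ^ m) * extRight k A (J ^ (n - m)) ≤ Q ^ n := by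
    intro m hm
    rw [extLeft_pow, extRight_pow, ← Nat.add_sub_cancel' hm, pow_add, Nat.add_sub_cancel' hm]
    exact Ideal.mul_mono (Ideal.pow_right_mono le_sup_left _)
      (Ideal.pow_right_mono le_sup_right _)
  -- the error term is tracked in `extRight (J ^ (n + 1 - m))`, so that the modular law applies
  have key : ∀ m ≤ n, f ∈ extLeft k B (I ^ m) ⊔ (Q ^ n ⊓ extRight k A (J ^ (n + 1 - m))) := by
    intro m
    induction m with
    | zero =>
      intro _
      rw [pow_zero, Ideal.one_eq_top, extLeft, Ideal.map_top]
      simp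
    | succ m ih =>
      intro hm
      obtain ⟨g, hg, h, ⟨hhQ, hhJ⟩, rfl⟩ := Submodule.mem_sup.1 (ih (by omega))
      obtain ⟨a, ha, b, hb, hab⟩ := Submodule.mem_sup.1 (H (m + 1) (n - m) hm (by omega) (by omega))
      have hJle : extRight k A (J ^ (n + 1 - m)) ≤ extRight k A (J ^ (n - m)) :=
        Ideal.map_mono (Ideal.pow_le_pow_right (by omega))
      have hIle : extLeft k B (I ^ (m + 1)) ≤ extLeft k B (I ^ m) :=
        Ideal.map_mono (Ideal.pow_le_pow_right (by omega))
      have hga : g - a ∈ extRight k A (J ^ (n - m)) := by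
        rw [show g - a = b - h by linear_combination hab.symm]
        exact sub_mem hb (hJle hhJ)
      have hga' : g - a ∈ extLeft k B (I ^ m) * extRight k A (J ^ (n - m)) :=
        extLeft_inf_extRight_le_mul _ _ ⟨sub_mem hg (hIle ha), hga⟩
      refine Submodule.mem_sup.2 ⟨a, ha, (g - a) + h, ⟨?_, ?_⟩, by ring⟩
      · exact add_mem (hQ m (by omega) hga') hhQ
      · rw [show n + 1 - (m + 1) = n - m by omega]
        exact add_mem hga (hJle hhJ)
  obtain ⟨g, hg, h, hh, hgh⟩ := Submodule.mem_sup.1 (key n le_rfl)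
  rw [← hgh]
  refine add_mem ?_ hh.1
  rw [extLeft_pow] at hg
  exact Ideal.pow_right_mono le_sup_left _ hg

end Ext

/-! ### Going down and contraction of minimal primes -/

theorem Ideal.exists_prime_le_comap_eq_of_surjective {A R S : Type*} [CommRing A] [CommRing R]
    [CommRing S] [Algebra A S] [Module.Flat A S] (i : A →+* R) (π : R →+* S)
    (hπ : Function.Surjective π) (hi : π.comp i = algebraMap A S) (P : Ideal R) [P.IsPrime]
    (hker : RingHom.ker π ≤ P) (p : Ideal A) [p.IsPrime] (hp : p ≤ P.comap i) :
    ∃ P₀ ≤ P, P₀.IsPrime ∧ P₀.comap i = p ∧ RingHom.ker π ≤ P₀ := by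
  have : (P.map π).IsPrime := Ideal.map_isPrime_of_surjective hπ hker
  have hcomap : (P.map π).comap π = P := by
    rw [Ideal.comap_map_of_surjective' _ hπ, sup_eq_left.2 hker]
  have hunder : (P.map π).under A = P.comap i := by
    rw [Ideal.under, ← hi, ← Ideal.comap_comap, hcomap]
  have : (P.map π).LiesOver ((P.map π).under A) := ⟨rfl⟩
  obtain ⟨P₁, hle, hP₁, hlies⟩ := Ideal.exists_ideal_le_liesOver_of_le (P.map π)
    (p := p) (q := (P.map π).under A) (hp.trans hunder.ge)
  refine ⟨P₁.comap π, (Ideal.comap_mono hle).trans hcomap.le, inferInstance, ?_,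
    Ideal.comap_mono bot_le⟩
  rw [Ideal.comap_comap, hi]
  exact hlies.over.symm

section Ext

variable {k A B : Type*} [Field k] [CommRing A] [CommRing B] [Algebra k A] [Algebra k B]

/-- Going down is applied to the flat map A → A ⊗ B/q rather than to A → A ⊗ B. The smaller prime
then still contains q, hence any ideal of B whose extension lies in `P`. -/
theorem exists_prime_le_comap_includeLeft_eq (P : Ideal (A ⊗[k] B)) [P.IsPrime]
    (p : Ideal A) [p.IsPrime]
    (hp : p ≤ P.comap (Algebra.TensorProduct.includeLeft : A →ₐ[k] A ⊗[k] B)) :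
    ∃ P₀ ≤ P, P₀.IsPrime ∧ P₀.comap (Algebra.TensorProduct.includeLeft : A →ₐ[k] A ⊗[k] B) = p ∧
      P.comap (Algebra.TensorProduct.includeRight : B →ₐ[k] A ⊗[k] B) ≤
        P₀.comap (Algebra.TensorProduct.includeRight : B →ₐ[k] A ⊗[k] B) := by
  generalize hq : P.comap (Algebra.TensorProduct.includeRight : B →ₐ[k] A ⊗[k] B) = q
  let π : A ⊗[k] B →ₐ[k] A ⊗[k] (B ⧸ q) :=
    Algebra.TensorProduct.map (AlgHom.id k A) (Ideal.Quotient.mkₐ k q)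
  have hπ : Function.Surjective π :=
    TensorProduct.map_surjective Function.surjective_id (Ideal.Quotient.mkₐ_surjective k q)
  have hker : RingHom.ker π.toRingHom ≤ P := by
    change RingHom.ker π ≤ P
    rw [Algebra.TensorProduct.map_ker (AlgHom.id k A) (Ideal.Quotient.mkₐ k q)
      Function.surjective_id (Ideal.Quotient.mkₐ_surjective k q), sup_le_iff,
      Ideal.map_le_iff_le_comap, Ideal.map_le_iff_le_comap]
    constructor
    · intro x hx
      have : x = 0 := hx
      simp [this]
    · intro x hx
      rw [hq]
      exact Ideal.Quotient.eq_zero_iff_mem.1 hx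
  obtain ⟨P₀, hle, hP₀, hcomap, hker'⟩ := Ideal.exists_prime_le_comap_eq_of_surjective
    (Algebra.TensorProduct.includeLeft : A →ₐ[k] A ⊗[k] B).toRingHom π.toRingHom hπ
    (by ext a; simp [π]) P hker p hp
  refine ⟨P₀, hle, hP₀, hcomap, fun b hb ↦ hker' ?_⟩
  have : Ideal.Quotient.mk q b = 0 := Ideal.Quotient.eq_zero_iff_mem.2 hb
  simp [RingHom.mem_ker, π, this]

theorem comap_includeLeft_mem_minimalPrimes {I : Ideal A} {J : Ideal B} {P : Ideal (A ⊗[k] B)}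
    (hP : P ∈ (extLeft k B I + extRight k A J).minimalPrimes) :
    P.comap (Algebra.TensorProduct.includeLeft : A →ₐ[k] A ⊗[k] B) ∈ I.minimalPrimes := by
  have hprime : P.IsPrime := hP.1.1
  obtain ⟨hI, hJ⟩ := sup_le_iff.1 hP.1.2
  refine ⟨⟨inferInstance, Ideal.map_le_iff_le_comap.1 hI⟩, ?_⟩
  rintro p ⟨hp, hIp⟩ hpP
  obtain ⟨P₀, hle, hP₀, rfl, hB⟩ := exists_prime_le_comap_includeLeft_eq P p hpP
  exact Ideal.comap_mono (hP.2 ⟨hP₀, sup_le (Ideal.map_le_iff_le_comap.2 hIp)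
    (Ideal.map_le_iff_le_comap.2 ((Ideal.map_le_iff_le_comap.1 hJ).trans hB))⟩ hle)

theorem comap_includeRight_mem_minimalPrimes {I : Ideal A} {J : Ideal B} {P : Ideal (A ⊗[k] B)}
    (hP : P ∈ (extLeft k B I + extRight k A J).minimalPrimes) :
    P.comap (Algebra.TensorProduct.includeRight : B →ₐ[k] A ⊗[k] B) ∈ J.minimalPrimes := by
  have hprime : P.IsPrime := hP.1.1
  obtain ⟨hI, hJ⟩ := sup_le_iff.1 hP.1.2
  let e := Algebra.TensorProduct.comm k A B
  refine ⟨⟨inferInstance, Ideal.map_le_iff_le_comap.1 hJ⟩, ?_⟩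
  rintro q ⟨hq, hJq⟩ hqP
  obtain ⟨P₀, hle, hP₀, rfl, hA⟩ := exists_prime_le_comap_includeLeft_eq (P.comap e.symm) q
    (fun b hb ↦ by simpa [Ideal.mem_comap, e] using hqP hb)
  refine fun b hb ↦ ?_
  have hle' : P₀.comap e ≤ P := fun x hx ↦ by simpa [Ideal.mem_comap] using hle hx
  have := hP.2 (y := P₀.comap e) ⟨inferInstance, sup_le (Ideal.map_le_iff_le_comap.2 fun a ha ↦ ?_)
    (Ideal.map_le_iff_le_comap.2 fun b hb ↦ ?_)⟩ hle' hb
  · simpa [Ideal.mem_comap, e] using this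
  · have := hA (x := a) (by simpa [Ideal.mem_comap, e] using hI (Ideal.mem_map_of_mem _ ha))
    simpa [Ideal.mem_comap, e] using this
  · simpa [Ideal.mem_comap, e] using hJq hb

end Ext

/-! ### Minimality of annihilating primes for domains -/

section Field

variable {k : Type*} [Field k]

instance mvPolynomial_tensor_isDomain {σ K : Type*} [Field K] [Algebra k K] :
    IsDomain (MvPolynomial σ k ⊗[k] K) :=
  ((Algebra.TensorProduct.comm k _ _).trans
    ((MvPolynomial.algebraTensorAlgEquiv (σ := σ) k K).restrictScalars k)).toMulEquiv.isDomain _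

/-- Multiplication by `d` is injective on the domain D ⊗ L, and stays so after the flat base change
K ⊗_D (D ⊗ L) = K ⊗ L. -/
theorem eq_zero_of_map_mul_eq_zero_of_flat {D K L : Type*} [CommRing D] [CommRing K] [CommRing L]
    [Algebra k D] [Algebra k K] [Algebra k L] [Algebra D K] [IsScalarTower k D K]
    [Module.Flat D K] [IsDomain (D ⊗[k] L)] {d : D ⊗[k] L} (hd : d ≠ 0) {z : K ⊗[k] L}
    (h : Algebra.TensorProduct.map (IsScalarTower.toAlgHom k D K) (AlgHom.id k L) d * z = 0) :
    z = 0 := by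
  let e : K ⊗[D] (D ⊗[k] L) ≃ₐ[K] K ⊗[k] L := Algebra.TensorProduct.cancelBaseChange k D K K L
  let ι := Algebra.TensorProduct.map (IsScalarTower.toAlgHom k D K) (AlgHom.id k L)
  have he : ∀ c : D ⊗[k] L, e (1 ⊗ₜ c) = ι c := by
    intro c
    induction c with
    | zero => simp
    | add r s hr hs => rw [TensorProduct.tmul_add, map_add, hr, hs, map_add]
    | tmul p l => simp [e, ι, Algebra.smul_def]
  have hmul : ∀ w, e ((LinearMap.mulLeft D d).lTensor K w) = ι d * e w := by
    intro w
    induction w with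
    | zero => simp
    | add r s hr hs => rw [map_add, map_add, hr, hs, map_add, mul_add]
    | tmul p c =>
      have hsmul : ∀ c : D ⊗[k] L, p ⊗ₜ[D] c = p • ((1 : K) ⊗ₜ[D] c) := fun c ↦ by
        rw [TensorProduct.smul_tmul', smul_eq_mul, mul_one]
      rw [LinearMap.lTensor_tmul, hsmul, hsmul c, map_smul, map_smul, he, he,
        LinearMap.mulLeft_apply, map_mul, mul_smul_comm]
  obtain ⟨w, rfl⟩ := e.surjective z
  rw [EmbeddingLike.map_eq_zero_iff]
  have hinj : Function.Injective ((LinearMap.mulLeft D d).lTensor K) :=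
    Module.Flat.lTensor_preserves_injective_linearMap _ (mul_right_injective₀ hd)
  apply hinj
  apply e.injective
  rw [hmul, map_zero, map_zero]
  exact h

/-- Over a purely transcendental subextension, `K ⊗ L` has no torsion. -/
theorem eq_zero_of_map_aeval_mul_eq_zero {σ K L : Type*} [Field K] [Field L] [Algebra k K]
    [Algebra k L] {x : σ → K} (hx : AlgebraicIndependent k x) {d : MvPolynomial σ k ⊗[k] L}
    (hd : d ≠ 0) {z : K ⊗[k] L}
    (h : Algebra.TensorProduct.map (MvPolynomial.aeval x) (AlgHom.id k L) d * z = 0) : z = 0 := by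
  let D := MvPolynomial σ k
  let : Algebra D K := (MvPolynomial.aeval x).toAlgebra
  have : IsScalarTower k D K := IsScalarTower.of_algebraMap_eq fun a ↦ by
    simp [RingHom.algebraMap_toAlgebra, D]
  have : FaithfulSMul D K := (faithfulSMul_iff_algebraMap_injective D K).2 hx
  let : Algebra (FractionRing D) K := FractionRing.liftAlgebra D K
  have : IsScalarTower D (FractionRing D) K := FractionRing.isScalarTower_liftAlgebra D K
  have : Module.Flat D (FractionRing D) := IsLocalization.flat _ (nonZeroDivisors D)
  have : Module.Flat D K := Module.Flat.trans D (FractionRing D) K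
  have htower : IsScalarTower.toAlgHom k D K = MvPolynomial.aeval x := AlgHom.ext fun _ ↦ rfl
  exact eq_zero_of_map_mul_eq_zero_of_flat (D := D) hd (by rw [htower]; exact h)

end Field
section Domain

variable {k A B : Type*} [Field k] [CommRing A] [CommRing B] [Algebra k A] [Algebra k B]

/-- Torsion-freeness makes `P` meet k[x] ⊗ B in 0 for a transcendence basis x of A. As R/P₀ is
algebraic over k[x] ⊗ B, a nonzero ideal P/P₀ would have nonzero contraction. -/
theorem eq_of_prime_le_of_mul_eq_zero [IsDomain A] [IsDomain B] {K L : Type*} [Field K] [Field L]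
    [Algebra k K] [Algebra k L] [Algebra A K] [Algebra B L] [IsScalarTower k A K]
    [IsScalarTower k B L] [FaithfulSMul A K] [FaithfulSMul B L]
    {P₀ P : Ideal (A ⊗[k] B)} [P₀.IsPrime] (hle : P₀ ≤ P) {z : K ⊗[k] L} (hz : z ≠ 0)
    (h : ∀ u ∈ P, Algebra.TensorProduct.map (IsScalarTower.toAlgHom k A K)
      (IsScalarTower.toAlgHom k B L) u * z = 0) : P ≤ P₀ := by
  obtain ⟨σ, x, hx⟩ := exists_isTranscendenceBasis' k A
  let D := MvPolynomial σ k ⊗[k] B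
  let φ : D →ₐ[k] A ⊗[k] B := Algebra.TensorProduct.map (MvPolynomial.aeval x) (AlgHom.id k B)
  have hφt : ∀ p b, φ (p ⊗ₜ b) = MvPolynomial.aeval x p ⊗ₜ b := fun _ _ ↦ rfl
  have hincl : Function.Injective
      (Algebra.TensorProduct.includeLeft : MvPolynomial σ k →ₐ[k] D) :=
    Algebra.TensorProduct.includeLeft_injective (S := k) (FaithfulSMul.algebraMap_injective k B)
  have hφ : ∀ d : D, φ d ∈ P → d = 0 := by
    intro d hd
    by_contra hd0
    have hinj : Function.Injective (Algebra.TensorProduct.map (AlgHom.id k (MvPolynomial σ k))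
        (IsScalarTower.toAlgHom k B L)) :=
      Module.Flat.lTensor_preserves_injective_linearMap
        (IsScalarTower.toAlgHom k B L).toLinearMap (FaithfulSMul.algebraMap_injective B L)
    refine hz (eq_zero_of_map_aeval_mul_eq_zero (x := algebraMap A K ∘ x)
      (hx.1.map' (f := IsScalarTower.toAlgHom k A K) (FaithfulSMul.algebraMap_injective A K))
      ((map_ne_zero_iff _ hinj).2 hd0) ?_)
    rw [← h _ hd]
    congr 1
    rw [← AlgHom.comp_apply, ← AlgHom.comp_apply, ← Algebra.TensorProduct.map_comp,
      ← Algebra.TensorProduct.map_comp]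
    congr 2
    ext i
    simp
  let S := (A ⊗[k] B) ⧸ P₀
  let : Algebra D S := ((Ideal.Quotient.mk P₀).comp φ.toRingHom).toAlgebra
  have halg : ∀ d : D, algebraMap D S d = Ideal.Quotient.mk P₀ (φ d) := fun _ ↦ rfl
  have hinj : Function.Injective (algebraMap D S) := by
    rw [injective_iff_map_eq_zero]
    intro d hd
    exact hφ d (hle (Ideal.Quotient.eq_zero_iff_mem.1 hd))
  have : IsDomain D := hinj.isDomain
  have hS : ∀ s : A ⊗[k] B, IsAlgebraic D (Ideal.Quotient.mk P₀ s) := by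
    intro s
    induction s with
    | zero => simpa using isAlgebraic_zero
    | add r s hr hs => simpa using hr.add hs
    | tmul a b =>
      have hab : a ⊗ₜ[k] b = (a ⊗ₜ 1) * (1 ⊗ₜ b) := by simp
      rw [hab, map_mul]
      refine IsAlgebraic.mul ?_ ?_
      -- Algebraicity over the subalgebra generated by `x` is transported to the polynomial ring.
      · have := hx.isAlgebraic.isAlgebraic a
        refine this.ringHom_of_comp_eq
          ((Algebra.TensorProduct.includeLeft : MvPolynomial σ k →ₐ[k] D).toRingHom.comp
            hx.1.aevalEquiv.symm.toRingEquiv.toRingHom)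
          ((Ideal.Quotient.mk P₀).comp
            (Algebra.TensorProduct.includeLeft : A →ₐ[k] A ⊗[k] B).toRingHom) ?_ ?_
        · exact hincl.comp hx.1.aevalEquiv.symm.injective
        · ext y
          obtain ⟨p, rfl⟩ := hx.1.aevalEquiv.surjective y
          change Ideal.Quotient.mk P₀ (φ (hx.1.aevalEquiv.symm (hx.1.aevalEquiv p) ⊗ₜ 1)) =
            Ideal.Quotient.mk P₀ ((hx.1.aevalEquiv p : A) ⊗ₜ 1)
          simp [hφt]
      · have : Ideal.Quotient.mk P₀ ((1 : A) ⊗ₜ[k] b) =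
            algebraMap D S ((1 : MvPolynomial σ k) ⊗ₜ[k] b) := by
          rw [halg, hφt, map_one]
        rw [this]
        exact isAlgebraic_algebraMap _
  intro u hu
  by_contra hu0
  refine Ideal.comap_ne_bot_of_algebraic_mem (I := P.map (Ideal.Quotient.mk P₀))
    (mt Ideal.Quotient.eq_zero_iff_mem.1 hu0) (Ideal.mem_map_of_mem _ hu) (hS u) ?_
  rw [eq_bot_iff]
  intro d hd
  rw [Ideal.mem_comap, halg, ← Ideal.mem_comap, Ideal.comap_map_of_surjective' _
    Ideal.Quotient.mk_surjective, Ideal.mk_ker, sup_eq_left.2 hle] at hd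
  exact hφ d hd

end Domain

/-! ### Annihilators in tensor products of modules -/

section Action

variable {k A B : Type*} [Field k] [CommRing A] [CommRing B] [Algebra k A] [Algebra k B]
  {M M' N N' : Type*} [AddCommGroup M] [AddCommGroup M'] [AddCommGroup N] [AddCommGroup N']
  [Module k M] [Module k M'] [Module k N] [Module k N'] [Module A M] [Module A M'] [Module B N]
  [Module B N'] [IsScalarTower k A M] [IsScalarTower k A M'] [IsScalarTower k B N]
  [IsScalarTower k B N']

variable (k A B M N) in
/-- The action of `A ⊗ B` on `M ⊗ N` for an `A`-module `M` and a `B`-module `N`. -/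
noncomputable def tensorAction : A ⊗[k] B →ₐ[k] Module.End k (M ⊗[k] N) :=
  (Module.endTensorEndAlgHom (R := k) (S := k) (A := k) (M := M) (N := N)).comp
    (Algebra.TensorProduct.map (Algebra.lsmul k k M) (Algebra.lsmul k k N))

@[simp]
theorem tensorAction_tmul (a : A) (b : B) (m : M) (n : N) :
    tensorAction k A B M N (a ⊗ₜ b) (m ⊗ₜ n) = (a • m) ⊗ₜ (b • n) := rfl

theorem map_tensorAction (f : M →ₗ[A] M') (g : N →ₗ[B] N') (r : A ⊗[k] B) (z : M ⊗[k] N) :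
    TensorProduct.map (f.restrictScalars k) (g.restrictScalars k) (tensorAction k A B M N r z) =
      tensorAction k A B M' N' r
        (TensorProduct.map (f.restrictScalars k) (g.restrictScalars k) z) := by
  induction r with
  | zero => simp
  | add r s hr hs => simp only [map_add, LinearMap.add_apply, hr, hs]
  | tmul a b =>
    induction z with
    | zero => simp
    | add r s hr hs => simp only [map_add, hr, hs]
    | tmul m n => simp

theorem comm_tensorAction (r : A ⊗[k] B) (z : M ⊗[k] N) :
    TensorProduct.comm k M N (tensorAction k A B M N r z) =
      tensorAction k B A N M (Algebra.TensorProduct.comm k A B r) (TensorProduct.comm k M N z) := by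
  induction r with
  | zero => simp
  | add r s hr hs => simp only [map_add, LinearMap.add_apply, hr, hs]
  | tmul a b =>
    induction z with
    | zero => simp
    | add r s hr hs => simp only [map_add, hr, hs]
    | tmul m n => simp

theorem tensorAction_eq_mul {A' B' K L : Type*} [CommRing A'] [CommRing B'] [CommRing K]
    [CommRing L] [Algebra k A'] [Algebra k B'] [Algebra k K] [Algebra k L] [Algebra A K]
    [Algebra B L] [Algebra A A'] [Algebra B B'] [Algebra A' K] [Algebra B' L] [IsScalarTower k A K]
    [IsScalarTower k B L] [IsScalarTower k A A'] [IsScalarTower k B B'] [IsScalarTower k A' K]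
    [IsScalarTower k B' L] [IsScalarTower A A' K] [IsScalarTower B B' L]
    (r : A ⊗[k] B) (z : K ⊗[k] L) :
    tensorAction k A B K L r z =
      Algebra.TensorProduct.map (IsScalarTower.toAlgHom k A' K) (IsScalarTower.toAlgHom k B' L)
        (Algebra.TensorProduct.map (IsScalarTower.toAlgHom k A A')
          (IsScalarTower.toAlgHom k B B') r) * z := by
  induction r with
  | zero => simp
  | add r s hr hs => simp only [map_add, LinearMap.add_apply, hr, hs, add_mul]
  | tmul a b =>
    induction z with
    | zero => simp
    | add r s hr hs => simp only [map_add, hr, hs, mul_add]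
    | tmul m n => simp [Algebra.smul_def, ← IsScalarTower.algebraMap_apply]

theorem equivFinsuppOfBasisRight_tensorAction {ι : Type*} [DecidableEq ι] (b : Module.Basis ι k N) (a : A)
    (z : M ⊗[k] N) (i : ι) :
    TensorProduct.equivFinsuppOfBasisRight b (tensorAction k A B M N (a ⊗ₜ 1) z) i =
      a • TensorProduct.equivFinsuppOfBasisRight b z i := by
  induction z with
  | zero => simp
  | add r s hr hs => simp only [map_add, Finsupp.add_apply, hr, hs, smul_add]
  | tmul m n =>
    rw [tensorAction_tmul, one_smul, TensorProduct.equivFinsuppOfBasisRight_apply_tmul_apply,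
      TensorProduct.equivFinsuppOfBasisRight_apply_tmul_apply, smul_comm]

/-- An associated prime of `M ⊗ N` contracts to an associated prime of `M`. -/
theorem exists_smul_eq_zero_iff_mem_comap_includeLeft {P : Ideal (A ⊗[k] B)} [P.IsPrime]
    {z : M ⊗[k] N} (hP : ∀ u, u ∈ P ↔ tensorAction k A B M N u z = 0) :
    ∃ m : M, ∀ a : A, a • m = 0 ↔
      a ∈ P.comap (Algebra.TensorProduct.includeLeft : A →ₐ[k] A ⊗[k] B) := by
  classical
  let b := Module.Basis.ofVectorSpace k N
  let c := TensorProduct.equivFinsuppOfBasisRight (M := M) b z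
  have hc : ∀ a : A, a ∈ P.comap (Algebra.TensorProduct.includeLeft : A →ₐ[k] A ⊗[k] B) ↔
      ∀ i, a • c i = 0 := by
    intro a
    rw [Ideal.mem_comap, Algebra.TensorProduct.includeLeft_apply, hP,
      ← (TensorProduct.equivFinsuppOfBasisRight (M := M) b).map_eq_zero_iff, DFunLike.ext_iff]
    exact forall_congr' fun i ↦ by rw [equivFinsuppOfBasisRight_tensorAction]; rfl
  -- A prime containing a finite intersection of annihilators of coordinates contains one of them.
  have hle : c.support.inf (fun i ↦ LinearMap.ker (LinearMap.toSpanSingleton A M (c i))) ≤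
      P.comap (Algebra.TensorProduct.includeLeft : A →ₐ[k] A ⊗[k] B) := by
    intro a ha
    refine (hc a).2 fun i ↦ ?_
    by_cases hi : i ∈ c.support
    · exact Finset.inf_le (f := fun i ↦ LinearMap.ker (LinearMap.toSpanSingleton A M (c i))) hi ha
    · rw [Finsupp.notMem_support_iff.1 hi, smul_zero]
  obtain ⟨i, -, hi⟩ := (Ideal.IsPrime.inf_le' (hp := inferInstance)).1 hle
  exact ⟨c i, fun a ↦ ⟨fun h ↦ hi h, fun h ↦ (hc a).1 h i⟩⟩

theorem exists_injective_finsupp.{u, v, w} {A : Type u} {K : Type v} {M : Type w} [CommRing A] [IsDomain A] [Field K] [Algebra A K]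
    [IsFractionRing A K] [AddCommGroup M] [Module A M]
    (h : ∀ (s : A) (m : M), s ≠ 0 → s • m = 0 → m = 0) :
    ∃ (ι : Type (max v w)) (e : M →ₗ[A] (ι →₀ K)), Function.Injective e := by
  let b := Module.Basis.ofVectorSpace K (K ⊗[A] M)
  let e := b.repr.toLinearMap.restrictScalars A
  have he : Function.Injective e := b.repr.injective
  suffices Function.Injective (TensorProduct.mk A K M 1) from
    ⟨_, e ∘ₗ TensorProduct.mk A K M 1, he.comp this⟩
  rw [injective_iff_map_eq_zero]
  intro m hm
  obtain ⟨s, hs⟩ := (IsLocalizedModule.eq_zero_iff (nonZeroDivisors A) _).1 hm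
  exact h s m (nonZeroDivisors.ne_zero s.2) hs

/-- The coordinates of `z` in a basis of `N` are killed by `p`, so `z` comes from M' ⊗ N with M' the
`p`-torsion of `M`. M' is torsion-free over A/p and embeds in a K-vector space; project to a
coordinate where `z` survives. -/
theorem exists_tensorAction_fractionRing_left (p : Ideal A) [p.IsPrime] (K : Type*) [Field K]
    [Algebra k K] [Algebra A K] [Algebra (A ⧸ p) K] [IsFractionRing (A ⧸ p) K]
    [IsScalarTower A (A ⧸ p) K] [IsScalarTower k A K] {z : M ⊗[k] N} (hz : z ≠ 0)
    (hp : ∀ a ∈ p, tensorAction k A B M N (a ⊗ₜ 1) z = 0)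
    (h : ∀ (s : A) (m : M), s ∉ p → (∀ a ∈ p, a • m = 0) → s • m = 0 → m = 0) :
    ∃ z' : K ⊗[k] N, z' ≠ 0 ∧
      ∀ r, tensorAction k A B M N r z = 0 → tensorAction k A B K N r z' = 0 := by
  classical
  let M' := Submodule.torsionBySet A M (p : Set A)
  let j : M' ⊗[k] N →ₗ[k] M ⊗[k] N := TensorProduct.map (M'.subtype.restrictScalars k)
    ((LinearMap.id : N →ₗ[B] N).restrictScalars k)
  have hj : Function.Injective j :=
    Module.Flat.rTensor_preserves_injective_linearMap (M'.subtype.restrictScalars k)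
      M'.injective_subtype
  obtain ⟨z₁, rfl⟩ : z ∈ LinearMap.range j := by
    let b := Module.Basis.ofVectorSpace k N
    rw [← (TensorProduct.equivFinsuppOfBasisRight (M := M) b).symm_apply_apply z,
      TensorProduct.equivFinsuppOfBasisRight_symm_apply]
    refine Submodule.sum_mem _ fun i _ ↦ ?_
    refine ⟨(⟨TensorProduct.equivFinsuppOfBasisRight b z i, ?_⟩ : M') ⊗ₜ b i, rfl⟩
    rw [Submodule.mem_torsionBySet_iff]
    rintro ⟨a, ha⟩
    change a • _ = 0
    rw [← equivFinsuppOfBasisRight_tensorAction (B := B), hp a ha]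
    simp
  have hz₁ : z₁ ≠ 0 := fun h ↦ hz (by rw [h, map_zero])
  obtain ⟨ι, e, he⟩ := exists_injective_finsupp (A := A ⧸ p) (K := K) (M := M') (by
    intro s m hs hm
    obtain ⟨s, rfl⟩ := Ideal.Quotient.mk_surjective s
    refine Subtype.ext (h s m (mt Ideal.Quotient.eq_zero_iff_mem.2 hs) (fun a ha ↦ ?_) ?_)
    · exact (Submodule.mem_torsionBySet_iff _ _).1 m.2 ⟨a, ha⟩
    · exact congrArg Subtype.val hm)
  let e' : M' →ₗ[k] (ι →₀ K) := (e.restrictScalars A).restrictScalars k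
  have he' : e'.rTensor N z₁ ≠ 0 :=
    (map_ne_zero_iff _ (Module.Flat.rTensor_preserves_injective_linearMap e' he)).2 hz₁
  obtain ⟨i, hi⟩ : ∃ i, TensorProduct.finsuppLeft k k K N ι (e'.rTensor N z₁) i ≠ 0 := by
    by_contra! H
    exact he' ((TensorProduct.finsuppLeft k k K N ι).map_eq_zero_iff.1 (Finsupp.ext H))
  let ψ : M' →ₗ[A] K := Finsupp.lapply i ∘ₗ e.restrictScalars A
  refine ⟨TensorProduct.map (ψ.restrictScalars k) ((LinearMap.id : N →ₗ[B] N).restrictScalars k) z₁,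
    ?_, fun r hr ↦ ?_⟩
  · rw [TensorProduct.finsuppLeft_apply, ← LinearMap.comp_apply, ← LinearMap.rTensor_comp] at hi
    exact hi
  · rw [← map_tensorAction] at hr ⊢
    rw [hj (hr.trans (map_zero j).symm), map_zero]

end Action

/-! ### Associated primes and symbolic powers of the sum -/

section Main

variable {k A B : Type*} [Field k] [CommRing A] [CommRing B] [Algebra k A] [Algebra k B]

theorem symbolicPower_zero {R : Type*} [CommRing R] (Q : Ideal R) : symbolicPower Q 0 = Q ^ 0 :=
  le_antisymm (by simp) (pow_le_symbolicPower Q 0)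

theorem sup_pow_le_pow_sup_pow {R : Type*} [CommRing R] {X Y : Ideal R} {a b n : ℕ}
    (h : a + b ≤ n + 1) : (X + Y) ^ n ≤ X ^ a ⊔ Y ^ b := by
  rw [add_pow, Ideal.sum_eq_sup]
  refine Finset.sup_le fun i _ ↦ ?_
  by_cases hi : a ≤ i
  · exact Ideal.mul_le_left.trans (Ideal.mul_le_left.trans
      ((Ideal.pow_le_pow_right hi).trans le_sup_left))
  · exact Ideal.mul_le_left.trans (Ideal.mul_le_right.trans
      ((Ideal.pow_le_pow_right (by omega)).trans le_sup_right))

theorem exists_minimalPrime_of_ne_zero {I : Ideal A} {i : ℕ} (h : symbolicPower I i = I ^ i)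
    {m : A ⧸ I ^ i} (hm : m ≠ 0) : ∃ p ∈ I.minimalPrimes, ∀ s : A, s • m = 0 → s ∈ p := by
  obtain ⟨x, rfl⟩ := Ideal.Quotient.mk_surjective m
  have hx : x ∉ symbolicPower I i := h ▸ mt Ideal.Quotient.eq_zero_iff_mem.2 hm
  rw [mem_symbolicPower_iff] at hx
  push Not at hx
  obtain ⟨p, hp, H⟩ := hx
  refine ⟨p, hp, fun s hs ↦ ?_⟩
  by_contra hsp
  exact H s hsp (Ideal.Quotient.eq_zero_iff_mem.1 hs)

theorem mem_minimalPrimes_of_smul_eq_zero_iff {I : Ideal A} {i : ℕ} (h : symbolicPower I i = I ^ i)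
    {p : Ideal A} [p.IsPrime] {m : A ⧸ I ^ i} (hm : ∀ a : A, a • m = 0 ↔ a ∈ p) :
    p ∈ I.minimalPrimes := by
  have hm0 : m ≠ 0 := fun h0 ↦ (Ideal.ne_top_iff_one p).1 (Ideal.IsPrime.ne_top inferInstance)
    ((hm 1).1 (by rw [h0, smul_zero]))
  obtain ⟨p', hp', H⟩ := exists_minimalPrime_of_ne_zero h hm0
  have hIp : I ≤ p := fun a ha ↦ by
    refine Ideal.IsPrime.mem_of_pow_mem inferInstance i ((hm _).1 ?_)
    obtain ⟨x, rfl⟩ := Ideal.Quotient.mk_surjective m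
    exact Ideal.Quotient.eq_zero_iff_mem.2 (Ideal.mul_mem_right x _ (Ideal.pow_mem_pow ha i))
  have hle : p ≤ p' := fun a ha ↦ H a ((hm a).2 ha)
  rwa [hle.antisymm (hp'.2 ⟨inferInstance, hIp⟩ hle)]

/-- If m ≠ 0, its annihilator lies in a minimal prime of `I`. That prime contains `p`, so it equals
`p`, yet it contains `s`. -/
theorem eq_zero_of_smul_eq_zero_of_mem_minimalPrimes {I : Ideal A} {i : ℕ}
    (h : symbolicPower I i = I ^ i) {p : Ideal A} (hp : p ∈ I.minimalPrimes) (s : A)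
    (m : A ⧸ I ^ i) (hs : s ∉ p) (hpm : ∀ a ∈ p, a • m = 0) (hsm : s • m = 0) : m = 0 := by
  by_contra hm
  obtain ⟨p', hp', H⟩ := exists_minimalPrime_of_ne_zero h hm
  exact hs (hp'.2 hp.1 (fun a ha ↦ H a (hpm a ha)) (H s hsm))

theorem map_mk_eq (I : Ideal A) (J : Ideal B) :
    Algebra.TensorProduct.map (IsScalarTower.toAlgHom k A (A ⧸ I))
      (IsScalarTower.toAlgHom k B (B ⧸ J)) =
    Algebra.TensorProduct.map (Ideal.Quotient.mkₐ k I) (Ideal.Quotient.mkₐ k J) := rfl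

/-- A prime of `A ⊗ B` annihilating a nonzero element of a tensor product of modules which are
torsion-free modulo `p` and `q` is minimal among the primes lying over both `p` and `q`. -/
theorem le_of_tensorAction_eq_zero {M N : Type*} [AddCommGroup M] [AddCommGroup N] [Module k M]
    [Module k N] [Module A M] [Module B N] [IsScalarTower k A M] [IsScalarTower k B N]
    {p : Ideal A} {q : Ideal B} [p.IsPrime] [q.IsPrime] {P₀ P : Ideal (A ⊗[k] B)} [P₀.IsPrime]
    (hle : P₀ ≤ P) (hp : extLeft k B p ≤ P₀) (hq : extRight k A q ≤ P₀)
    (hM : ∀ (s : A) (m : M), s ∉ p → (∀ a ∈ p, a • m = 0) → s • m = 0 → m = 0)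
    (hN : ∀ (s : B) (m : N), s ∉ q → (∀ a ∈ q, a • m = 0) → s • m = 0 → m = 0)
    {z : M ⊗[k] N} (hz : z ≠ 0) (hP : ∀ u ∈ P, tensorAction k A B M N u z = 0) : P ≤ P₀ := by
  let K := FractionRing (A ⧸ p)
  let L := FractionRing (B ⧸ q)
  -- The modules are replaced by the residue fields one factor at a time, swapping factors for the
  -- second.
  obtain ⟨z₁, hz₁, h₁⟩ := exists_tensorAction_fractionRing_left p K hz
    (fun a ha ↦ hP _ (hle (hp (tmul_mem_extLeft ha 1)))) hM
  obtain ⟨z₂, hz₂, h₂⟩ := exists_tensorAction_fractionRing_left (A := B) (B := A) q L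
    (z := TensorProduct.comm k K N z₁) ((TensorProduct.comm k K N).map_ne_zero_iff.2 hz₁)
    (fun b hb ↦ by
      have := h₁ _ (hP _ (hle (hq (tmul_mem_extRight 1 hb))))
      rw [← (TensorProduct.comm k K N).map_eq_zero_iff, comm_tensorAction] at this
      exact this) hN
  have hP₂ : ∀ u ∈ P, tensorAction k A B K L u (TensorProduct.comm k L K z₂) = 0 := by
    intro u hu
    have := h₁ _ (hP u hu)
    rw [← (TensorProduct.comm k K N).map_eq_zero_iff, comm_tensorAction] at this
    have := h₂ _ this
    rw [← (TensorProduct.comm k L K).map_eq_zero_iff, comm_tensorAction] at this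
    rwa [← Algebra.TensorProduct.comm_symm k A B, AlgEquiv.symm_apply_apply] at this
  let π : A ⊗[k] B →ₐ[k] (A ⧸ p) ⊗[k] (B ⧸ q) :=
    Algebra.TensorProduct.map (Ideal.Quotient.mkₐ k p) (Ideal.Quotient.mkₐ k q)
  have hπ : Function.Surjective π :=
    TensorProduct.map_surjective (Ideal.Quotient.mkₐ_surjective k p)
      (Ideal.Quotient.mkₐ_surjective k q)
  have hker : RingHom.ker π ≤ P₀ := by
    rw [ker_map_mk]
    exact sup_le hp hq
  have : (P₀.map π).IsPrime := Ideal.map_isPrime_of_surjective hπ hker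
  have key : P.map π ≤ P₀.map π := by
    refine eq_of_prime_le_of_mul_eq_zero (K := K) (L := L) (Ideal.map_mono hle)
      ((TensorProduct.comm k L K).map_ne_zero_iff.2 hz₂) fun u hu ↦ ?_
    obtain ⟨v, hv, rfl⟩ := (Ideal.mem_map_iff_of_surjective π hπ).1 hu
    rw [← hP₂ v hv, tensorAction_eq_mul (A' := A ⧸ p) (B' := B ⧸ q), map_mk_eq]
  have := Ideal.comap_mono (f := π) key
  rwa [Ideal.comap_map_of_surjective' _ hπ, Ideal.comap_map_of_surjective' _ hπ,
    sup_eq_left.2 hker, sup_eq_left.2 (hker.trans hle)] at this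

theorem exists_smul_eq_zero_iff_mem_comap_includeRight {M N : Type*} [AddCommGroup M]
    [AddCommGroup N] [Module k M] [Module k N] [Module A M] [Module B N] [IsScalarTower k A M]
    [IsScalarTower k B N] {P : Ideal (A ⊗[k] B)} [P.IsPrime] {z : M ⊗[k] N}
    (hP : ∀ u, u ∈ P ↔ tensorAction k A B M N u z = 0) :
    ∃ m : N, ∀ b : B, b • m = 0 ↔
      b ∈ P.comap (Algebra.TensorProduct.includeRight : B →ₐ[k] A ⊗[k] B) := by
  let e := Algebra.TensorProduct.comm k A B
  obtain ⟨m, hm⟩ := exists_smul_eq_zero_iff_mem_comap_includeLeft (P := P.comap e.symm)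
    (z := TensorProduct.comm k M N z) fun u ↦ by
      rw [Ideal.mem_comap, hP, ← (TensorProduct.comm k M N).map_eq_zero_iff, comm_tensorAction,
        AlgEquiv.apply_symm_apply]
  exact ⟨m, fun b ↦ (hm b).trans (by simp [Ideal.mem_comap, e])⟩

/-- `P` contracts to minimal primes of `I` and `J`, so every smaller prime over I + J has the same
contractions and `le_of_tensorAction_eq_zero` applies. -/
theorem associatedPrime_mem_minimalPrimes {I : Ideal A} {J : Ideal B} {i j : ℕ}
    (hI : symbolicPower I i = I ^ i) (hJ : symbolicPower J j = J ^ j) {P : Ideal (A ⊗[k] B)}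
    [P.IsPrime] {z : (A ⧸ I ^ i) ⊗[k] (B ⧸ J ^ j)}
    (hP : ∀ u, u ∈ P ↔ tensorAction k A B (A ⧸ I ^ i) (B ⧸ J ^ j) u z = 0) :
    P ∈ (extLeft k B I + extRight k A J).minimalPrimes := by
  obtain ⟨m, hm⟩ := exists_smul_eq_zero_iff_mem_comap_includeLeft hP
  obtain ⟨m', hm'⟩ := exists_smul_eq_zero_iff_mem_comap_includeRight hP
  have hp := mem_minimalPrimes_of_smul_eq_zero_iff hI hm
  have hq := mem_minimalPrimes_of_smul_eq_zero_iff hJ hm'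
  have hz : z ≠ 0 := by
    rintro rfl
    exact (Ideal.ne_top_iff_one P).1 (Ideal.IsPrime.ne_top inferInstance) ((hP 1).2 (map_zero _))
  refine ⟨⟨inferInstance, sup_le (Ideal.map_le_iff_le_comap.2 hp.1.2)
    (Ideal.map_le_iff_le_comap.2 hq.1.2)⟩, ?_⟩
  rintro P₀ ⟨hP₀, hQ⟩ hle
  obtain ⟨hIP, hJP⟩ := sup_le_iff.1 hQ
  exact le_of_tensorAction_eq_zero hle
    (Ideal.map_le_iff_le_comap.2
      (hp.2 ⟨inferInstance, Ideal.map_le_iff_le_comap.1 hIP⟩ (Ideal.comap_mono hle)))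
    (Ideal.map_le_iff_le_comap.2
      (hq.2 ⟨inferInstance, Ideal.map_le_iff_le_comap.1 hJP⟩ (Ideal.comap_mono hle)))
    (eq_zero_of_smul_eq_zero_of_mem_minimalPrimes hI hp)
    (eq_zero_of_smul_eq_zero_of_mem_minimalPrimes hJ hq) hz fun u hu ↦ (hP u).1 hu

/-- If f ∉ I^i + J^j, some associated prime of the quotient contains the annihilator of f. It is
minimal over I + J, so a multiplier outside it carries f into (I + J)^n ⊆ I^i + J^j, a
contradiction. -/
theorem symbolicPower_add_le [IsNoetherianRing (A ⊗[k] B)] {I : Ideal A} {J : Ideal B} {n : ℕ}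
    (h : ∀ t ≤ n, symbolicPower I t = I ^ t ∧ symbolicPower J t = J ^ t) :
    symbolicPower (extLeft k B I + extRight k A J) n ≤ (extLeft k B I + extRight k A J) ^ n := by
  intro f hf
  by_contra hfn
  obtain ⟨i, j, hi, hj, hij, hfij⟩ := exists_notMem_sup_of_notMem_pow hfn
  let R := A ⊗[k] B
  let T := extLeft k B (I ^ i) ⊔ extRight k A (J ^ j)
  obtain ⟨P, hP, hle⟩ := exists_le_isAssociatedPrime_of_isNoetherianRing R
    (Ideal.Quotient.mk T f) (mt Ideal.Quotient.eq_zero_iff_mem.1 hfij)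
  obtain ⟨hprime, y, hy⟩ := isAssociatedPrime_iff.1 hP
  obtain ⟨z, rfl⟩ := Ideal.Quotient.mk_surjective y
  have hPT : ∀ u : R, u ∈ P ↔ u * z ∈ T := fun u ↦ by
    rw [hy, Submodule.mem_colon_singleton, Submodule.mem_bot]
    exact Ideal.Quotient.eq_zero_iff_mem
  have hmin : P ∈ (extLeft k B I + extRight k A J).minimalPrimes := by
    refine associatedPrime_mem_minimalPrimes (h i hi).1 (h j hj).2
      (z := Algebra.TensorProduct.map (Ideal.Quotient.mkₐ k (I ^ i))
        (Ideal.Quotient.mkₐ k (J ^ j)) z) fun u ↦ ?_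
    rw [tensorAction_eq_mul (A' := A ⧸ I ^ i) (B' := B ⧸ J ^ j), map_mk_eq, hPT]
    change _ ∈ extLeft k B (I ^ i) ⊔ extRight k A (J ^ j) ↔ _
    rw [← ker_map_mk, RingHom.mem_ker, map_mul]
    have hid : Algebra.TensorProduct.map (IsScalarTower.toAlgHom k (A ⧸ I ^ i) (A ⧸ I ^ i))
        (IsScalarTower.toAlgHom k (B ⧸ J ^ j) (B ⧸ J ^ j)) = AlgHom.id k _ := by
      ext <;> rfl
    rw [hid, AlgHom.id_apply]
  obtain ⟨s, hs, hsf⟩ := mem_symbolicPower_iff.1 hf P hmin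
  refine hs (hle ?_)
  rw [Submodule.mem_colon_singleton, Submodule.mem_bot]
  refine Ideal.Quotient.eq_zero_iff_mem.2 ?_
  change s * f ∈ extLeft k B (I ^ i) ⊔ extRight k A (J ^ j)
  rw [extLeft_pow, extRight_pow]
  exact sup_pow_le_pow_sup_pow hij hsf

/-! ### Descent to the factors by pure tensors -/

theorem mem_pow_or_mem_pow_of_tmul_mem {I : Ideal A} {J : Ideal B} {x : A} {y : B}
    (h : x ⊗ₜ[k] y ∈ extLeft k B I ⊔ extRight k A J) : x ∈ I ∨ y ∈ J := by
  classical
  rw [← ker_map_mk, RingHom.mem_ker, Algebra.TensorProduct.map_tmul] at h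
  by_contra! H
  have hx : Ideal.Quotient.mkₐ k I x ≠ 0 := mt Ideal.Quotient.eq_zero_iff_mem.1 H.1
  let b := Module.Basis.ofVectorSpace k (B ⧸ J)
  refine H.2 (Ideal.Quotient.eq_zero_iff_mem.1 (b.ext_elem (fun i ↦ ?_)))
  have hi := congrArg (fun w ↦ TensorProduct.equivFinsuppOfBasisRight b w i) h
  simp only [TensorProduct.equivFinsuppOfBasisRight_apply_tmul_apply, map_zero,
    Finsupp.zero_apply] at hi ⊢
  exact (smul_eq_zero.1 hi).resolve_right hx

theorem tmul_mem_symbolicPower {I : Ideal A} {J : Ideal B} {s t : ℕ} {x : A} {y : B}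
    (hx : x ∈ symbolicPower I s) (hy : y ∈ symbolicPower J t) :
    x ⊗ₜ[k] y ∈ symbolicPower (extLeft k B I + extRight k A J) (s + t) := by
  rw [mem_symbolicPower_iff] at *
  intro P hP
  have hprime : P.IsPrime := hP.1.1
  obtain ⟨a, ha, hax⟩ := hx _ (comap_includeLeft_mem_minimalPrimes hP)
  obtain ⟨b, hb, hby⟩ := hy _ (comap_includeRight_mem_minimalPrimes hP)
  refine ⟨(a ⊗ₜ 1) * (1 ⊗ₜ b), fun h ↦ (hprime.mem_or_mem h).elim ha hb, ?_⟩
  have : (a ⊗ₜ[k] (1 : B)) * ((1 : A) ⊗ₜ[k] b) * (x ⊗ₜ y) = ((a * x) ⊗ₜ 1) * (1 ⊗ₜ (b * y)) := by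
    simp
  rw [this, pow_add]
  refine Ideal.mul_mem_mul ?_ ?_
  · exact Ideal.pow_right_mono le_sup_left _
      (extLeft_pow (k := k) (B := B) I s ▸ tmul_mem_extLeft hax 1)
  · exact Ideal.pow_right_mono le_sup_right _
      (extRight_pow (k := k) (A := A) J t ▸ tmul_mem_extRight 1 hby)

theorem symbolicPower_left_eq_pow {I : Ideal A} {J : Ideal B} {s t : ℕ}
    (h : symbolicPower (extLeft k B I + extRight k A J) (s + t) =
      (extLeft k B I + extRight k A J) ^ (s + t)) (hJ : J ^ t ≠ J ^ (t + 1)) :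
    symbolicPower I s = I ^ s := by
  refine le_antisymm (fun x hx ↦ ?_) (pow_le_symbolicPower I s)
  obtain ⟨y, hy, hy'⟩ := Set.not_subset.1 fun H : J ^ t ≤ J ^ (t + 1) ↦
    hJ (le_antisymm H (Ideal.pow_le_pow_right t.le_succ))
  have := tmul_mem_symbolicPower (k := k) hx (pow_le_symbolicPower J t hy)
  rw [h] at this
  have := sup_pow_le_pow_sup_pow (a := s) (b := t + 1) (by omega) this
  rw [← extLeft_pow, ← extRight_pow] at this
  exact (mem_pow_or_mem_pow_of_tmul_mem this).resolve_right hy'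

theorem symbolicPower_right_eq_pow {I : Ideal A} {J : Ideal B} {s t : ℕ}
    (h : symbolicPower (extLeft k B I + extRight k A J) (s + t) =
      (extLeft k B I + extRight k A J) ^ (s + t)) (hI : I ^ s ≠ I ^ (s + 1)) :
    symbolicPower J t = J ^ t := by
  refine le_antisymm (fun y hy ↦ ?_) (pow_le_symbolicPower J t)
  obtain ⟨x, hx, hx'⟩ := Set.not_subset.1 fun H : I ^ s ≤ I ^ (s + 1) ↦
    hI (le_antisymm H (Ideal.pow_le_pow_right s.le_succ))
  have := tmul_mem_symbolicPower (k := k) (pow_le_symbolicPower I s hx) hy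
  rw [h] at this
  have := sup_pow_le_pow_sup_pow (a := s + 1) (b := t) (by omega) this
  rw [← extLeft_pow, ← extRight_pow] at this
  exact (mem_pow_or_mem_pow_of_tmul_mem this).resolve_left hx'

end Main

theorem corollary3p6 {k A B : Type*} [Field k] [CommRing A] [CommRing B] [Algebra k A] [Algebra k B]
    [IsNoetherianRing A] [IsNoetherianRing B] [IsNoetherianRing (A ⊗[k] B)]
    (I : Ideal A) (J : Ideal B) (hI₀ : I ≠ ⊥) (hI₁ : I ≠ ⊤) (hJ₀ : J ≠ ⊥) (hJ₁ : J ≠ ⊤)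
    (n : ℕ) (hn : 1 ≤ n)
    (hI : ∀ t ≤ n - 1, I ^ t ≠ I ^ (t + 1)) (hJ : ∀ t ≤ n - 1, J ^ t ≠ J ^ (t + 1)) :
    symbolicPower (extLeft k B I + extRight k A J) n = (extLeft k B I + extRight k A J) ^ n ↔
      ∀ t ≤ n, symbolicPower I t = I ^ t ∧ symbolicPower J t = J ^ t := by
  refine ⟨fun h t ht ↦ ?_, fun h ↦ le_antisymm (symbolicPower_add_le h) (pow_le_symbolicPower _ _)⟩
  -- For `t = 0` the exponent `n - t` would exceed `n - 1`, the range of `hI` and `hJ`.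
  rcases Nat.eq_zero_or_pos t with rfl | ht0
  · exact ⟨symbolicPower_zero I, symbolicPower_zero J⟩
  · constructor
    · refine symbolicPower_left_eq_pow (k := k) (J := J) (s := t) (t := n - t) ?_
        (hJ _ (by omega))
      rwa [Nat.add_sub_cancel' ht]
    · refine symbolicPower_right_eq_pow (k := k) (I := I) (s := n - t) (t := t) ?_
        (hI _ (by omega))
      rwa [Nat.sub_add_cancel ht]
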